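/- Let $X$ be a finite simple $(q+1)$-regular graph with vertex set $VX$, where $q\ge 0$ is an integer, and let $t,u\in\mathbb C$. **Operators.** Let $D$ and $A$ be the valency and adjacency operators of $X$ and $\Delta_X=D-A$ its Laplacian, acting on functions on $VX$. For an operator $B$ put $B(x_0,x)=(B\delta_{x_0})(x)$. A path of length $m$ is a sequence $C=(e_1,\dots,e_m)$ of consecutive oriented edges (a vertex if $m=0$), and $\mathrm{bc}(C)=\#\{1\le i\le m-1 : e_i=\overline{e_{i+1}}\}$ is its bump count. Let $$(C_m(t)f)(x)=\sum_{C} t^{\mathrm{bc}(C)}f(\text{end point of }C),$$ the sum being over all paths $C$ of length $m$ starting at $x$. Let $I(t)=(1-t)I$ and $Q_X(t)=D-I(t)$. For $m\ge1$ let $R_m(t)$ be the multiplication by the function $$R_m(t)(x)=\sum_{j=1}^{\lceil m/2\rceil-1}\sum_{i=1}^{j}(1-t)^{2(j-i)}(1-t^2)^{i-1}\,\bigl[\Delta_X\bigl(y\mapsto C_{m-2j}(t)(y,y)\bigr)\bigr](x),$$ so that $R_m(t)(x_0,x)=\delta_{x_0}(x)R_m(t)(x_0)$. Let $C^{\mathrm{cbc}}_m(t)=C_m(t)$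 for $m\in\{0,1\}$, $C^{\mathrm{cbc}}_2(t)=tC_2(t)$, and for $m\ge3$ $$C^{\mathrm{cbc}}_m(t)=C_m(t)-\frac{Q_X(t)-I(t)}{1-t}\sum_{j=1}^{\lceil m/2\rceil-1}(1-t)^{2j}C_{m-2j}(t)+(1-t)R_m(t)-\delta_{2\mathbb Z}(m)(1-t)^{m-1}t\,D,$$ where $\delta_{2\mathbb Z}(m)$ is $1$ for even $m$ and $0$ for odd $m$. The generalized Bartholdi zeta function is $$Z_X(u,t,x_0,x)=\exp\Bigl(\sum_{m=1}^\infty \frac{C_m^{\mathrm{cbc}}(t)(x_0,x)}{m}u^m\Bigr).$$ **Local spectrum.** For $\lambda\in\mathbb R$ let $E_\lambda$ be the orthogonal projection onto the $\lambda$-eigenspace of $\Delta_X$, and put $m_{x_0,x}(\lambda)=E_\lambda(x_0,x)$ and $m_{x_0}(\lambda)=m_{x_0,x_0}(\lambda)$, the $x_0$-local multiplicity. Let $\sigma_{x_0}(\Delta_X)$ be the set of eigenvalues $\lambda$ of $\Delta_X$ with $m_{x_0}(\lambda)>0$. **Statement.** Let $M=q+1$ be the maximal degree and $\alpha(t)=\tfrac12\bigl(M+\sqrt{M^2+4(|t|+1)M}\bigr)$.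 If $|t|<1$ and $|u|<1/\alpha(t)$, then for all $x_0,x\in VX$ the series $\sum_{m\ge1}C^{\mathrm{cbc}}_m(t)(x_0,x)u^m/m$ and $\sum_{m\ge3}(1-t)R_m(t)(x_0,x)u^m/m$ converge absolutely, and $$\begin{aligned}Z_X(u,t,x_0,x)={}&\bigl(1-(1-t)^2u^2\bigr)^{-\frac{q-1}{2}\delta_{x_0}(x)}\prod_{\lambda\in\sigma_{x_0}(\Delta_X)}\bigl(1-(q+1-\lambda)u+(1-t)(q+t)u^2\bigr)^{-m_{x_0,x}(\lambda)}\\&\times\exp\Bigl(\frac{[tD-C_2(t)](x_0,x)}{2}(1-t)u^2\Bigr)\exp\Bigl(\sum_{m=3}^\infty\frac{(1-t)R_m(t)(x_0,x)}{m}u^m\Bigr).\end{aligned}$$ In particular, for $x=x_0$ the exponents in the product are $-m_{x_0}(\lambda)$, the negatives of the $x_0$-local multiplicities. All complex powers are principal. -/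

import Mathlib

namespace BartholdiZeta

open scoped BigOperators

section Paths

variable {V : Type*} [DecidableEq V] {G : SimpleGraph V}

/-- The bump count `bc(C)` of a path `C = (e₁, …, eₙ)` (a walk, regarded as its list of oriented
edges): the number of consecutive pairs `(eᵢ, eᵢ₊₁)`, `1 ≤ i ≤ n - 1`, such that `eᵢ` is the
inverse edge of `eᵢ₊₁`. It is `0` for paths of length `0`. -/
def bumpCount {x y : V} (C : G.Walk x y) : ℕ :=
  (C.darts.zip C.darts.tail).countP (fun p => decide (p.1 = p.2.symm))

end Paths

section Operators

variable {V : Type*} [Fintype V] [DecidableEq V]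

/-- For an operator `B` on the functions on the (finite) vertex set, given by its matrix,
`B(x₁, x₂) = (B δ_{x₁})(x₂)`. -/
noncomputable def kernel (B : Matrix V V ℂ) (x₁ x₂ : V) : ℂ :=
  B.mulVec (Pi.single x₁ 1) x₂

variable (G : SimpleGraph V) [DecidableRel G.Adj]

/-- The operator `C_m(t)`, `(C_m(t) f)(x) = ∑_C t^{bc(C)} f(t(C))`, where `C` runs through
all paths of length `m` starting at `x`, and `t(C)` is the end point of `C`. -/
noncomputable def pathOp (t : ℂ) (m : ℕ) : Matrix V V ℂ :=
  Matrix.of fun x y => ∑ C ∈ G.finsetWalkLength m x y, t ^ bumpCount C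

/-- `R_m(t)(x) = ∑_{j=1}^{⌈m/2⌉-1} ∑_{i=1}^{j} (1-t)^{2(j-i)} (1-t²)^{i-1} [Δ C_{m-2j}(t)](x, x)`,
where the Laplacian is applied to the function `y ↦ C_{m-2j}(t)(y, y)`.
Here `(m + 1) / 2` is the ceiling of `m / 2`. -/
noncomputable def Rcoeff (t : ℂ) (m : ℕ) (x : V) : ℂ :=
  ∑ j ∈ Finset.Icc 1 ((m + 1) / 2 - 1), ∑ i ∈ Finset.Icc 1 j,
    (1 - t) ^ (2 * (j - i)) * (1 - t ^ 2) ^ (i - 1) *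
      (G.lapMatrix ℂ).mulVec (fun y => kernel (pathOp G t (m - 2 * j)) y y) x

/-- The operator of multiplication by the function `R_m(t)`. -/
noncomputable def Rop (t : ℂ) (m : ℕ) : Matrix V V ℂ :=
  Matrix.diagonal (Rcoeff G t m)

/-- `I(t) = (1 - t) I`. -/
noncomputable def It (t : ℂ) : Matrix V V ℂ := (1 - t) • 1

/-- `Q(t) = D - I(t)`, with `D` the valency operator. -/
noncomputable def Qt (t : ℂ) : Matrix V V ℂ := G.degMatrix ℂ - It t

/-- The operator `C_m^{cbc}(t)`. -/
noncomputable def cbcOp (t : ℂ) (m : ℕ) : Matrix V V ℂ :=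
  if m ≤ 1 then pathOp G t m
  else if m = 2 then t • pathOp G t 2
  else
    pathOp G t m
      - ((1 - t)⁻¹ • (Qt G t - It t)) *
          ∑ j ∈ Finset.Icc 1 ((m + 1) / 2 - 1), (1 - t) ^ (2 * j) • pathOp G t (m - 2 * j)
      + (1 - t) • Rop G t m
      - (if Even m then ((1 - t) ^ (m - 1) * t) • G.degMatrix ℂ else 0)

/-- The `m`-th term `C_m^{cbc}(t)(x₀, x) uᵐ / m` of the logarithm of the Bartholdi zeta
function. -/
noncomputable def zetaTerm (u t : ℂ) (x₀ x : V) (m : ℕ) : ℂ :=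
  kernel (cbcOp G t m) x₀ x / (m : ℂ) * u ^ m

/-- The generalized Bartholdi zeta function
`Z(u, t, x₀, x) = exp (∑_{m ≥ 1} C_m^{cbc}(t)(x₀, x) uᵐ / m)`. -/
noncomputable def bartholdiZeta (u t : ℂ) (x₀ x : V) : ℂ :=
  Complex.exp (∑' m : ℕ, zetaTerm G u t x₀ x (m + 1))

/-- The `m`-th term `(1 - t) R_m(t)(x₀, x) uᵐ / m` of the last correction exponent. -/
noncomputable def RTerm (u t : ℂ) (x₀ x : V) (m : ℕ) : ℂ :=
  (1 - t) * kernel (Rop G t m) x₀ x / (m : ℂ) * u ^ m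

/-- `α(t) = (M + √(M² + 4 (|t| + 1) M)) / 2`, with `M` the maximum of all degrees. -/
noncomputable def alpha (t : ℂ) : ℝ :=
  ((G.maxDegree : ℝ) +
    Real.sqrt ((G.maxDegree : ℝ) ^ 2 + 4 * (‖t‖ + 1) * (G.maxDegree : ℝ))) / 2

/-- The Laplacian `Δ = D - A` as an operator on the Euclidean space of functions on `V`. -/
noncomputable def laplacian : Module.End ℝ (EuclideanSpace ℝ V) :=
  Matrix.toEuclideanLin (G.lapMatrix ℝ)

/-- The primitive idempotent `E_μ` of the Laplacian: the orthogonal projection onto the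
eigenspace of `μ`. -/
noncomputable def primIdempotent (μ : ℝ) : EuclideanSpace ℝ V →L[ℝ] EuclideanSpace ℝ V :=
  (Module.End.eigenspace (laplacian G) μ).starProjection

/-- The entry `(E_μ δ_{x₀})(x) = ⟨E_μ δ_{x₀}, δ_x⟩` of the primitive idempotent, i.e. the
crossed local multiplicity of `μ` at `(x₀, x)`. -/
noncomputable def crossedMult (x₀ x : V) (μ : ℝ) : ℝ :=
  primIdempotent G μ (EuclideanSpace.single x₀ 1) x

/-- The `x`-local multiplicity `m_x(μ)`: the `xx`-entry of `E_μ`. -/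
noncomputable def localMult (x : V) (μ : ℝ) : ℝ := crossedMult G x x μ

open Classical in
/-- The (support of the) `x`-local spectrum of the Laplacian: the finite set of the eigenvalues
whose `x`-local multiplicity is positive. -/
noncomputable def localSpectrum (x : V) : Finset ℝ :=
  {μ ∈ (laplacian G).finite_hasEigenvalue.toFinset | 0 < localMult G x μ}

/-- `1 - (q + 1 - μ) u + (1 - t)(q + t) u²`. -/
noncomputable def localFactor (q : ℕ) (u t : ℂ) (μ : ℝ) : ℂ :=
  1 - ((q : ℂ) + 1 - (μ : ℂ)) * u + (1 - t) * ((q : ℂ) + t) * u ^ 2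

end Operators

end BartholdiZeta

/-! In a regular graph everything except `R_m(t)` is a polynomial in the adjacency operator.
Prepending an edge to a path gives a three-term recursion for `C_m(t)`, so on an eigenvector with
adjacency eigenvalue `a = q + 1 - μ` it acts by a scalar `pathCoeff`. Let `r₁, r₂` be the roots of
`z² - a z + (1 - t)(q + t)` and `s = 1 - t`. The correction sum telescopes, and `cbcCoeff_eq` gives
the scalar of `C_m^{cbc}(t)` without `R_m(t)`, for `m ≥ 1`: `r₁ᵐ + r₂ᵐ + (q - 1)/2 · (sᵐ + (-s)ᵐ)`.
Summed against `uᵐ/m`, the two pairs of powers give minus the logarithms of `1 - a u + (1 - t)(q +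
t) u²` and of `1 - s² u²`.

Decomposing `δ_{x₀}` into Laplacian eigenvectors (`kernel_eq_sum`) weights these logarithms by
crossed multiplicities, whose sum is `δ_{x₀}(x)`. The definition at `m = 2` departs from the uniform
formula, whence the `u²` exponential; `R_m(t)` supplies the last one.

For convergence, `α(t)` is the positive root of `r² = M r + (|t| + 1) M`, which majorizes the
recursion: it bounds `|r₁|`, `|r₂|`, `|s|` and the growth rate of `C_m(t)`. -/

namespace BartholdiZeta

/-! ### Bump counts under prepending an edge. -/

section Walks

variable {V : Type*} (G : SimpleGraph V)

theorem sum_adjMatrix_row [Fintype V] [DecidableRel G.Adj] (x : V) : ∑ w, G.adjMatrix ℂ x w = G.degree x := by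
  simp [SimpleGraph.adjMatrix_apply, SimpleGraph.degree_eq_sum_if_adj]

theorem adjMatrix_sq_apply [DecidableRel G.Adj] (x w : V) :
    G.adjMatrix ℂ x w * G.adjMatrix ℂ w x = G.adjMatrix ℂ x w := by
  by_cases h : G.Adj x w <;> simp [SimpleGraph.adjMatrix_apply, h, G.adj_comm w x]

theorem bumpCount_cons_nil [DecidableEq V] {x y : V} (h : G.Adj x y) :
    bumpCount (SimpleGraph.Walk.cons h SimpleGraph.Walk.nil) = 0 := by
  simp [bumpCount]

theorem bumpCount_cons_cons [DecidableEq V] {x w z y : V} (h : G.Adj x w) (h' : G.Adj w z) (p : G.Walk z y) :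
    bumpCount (SimpleGraph.Walk.cons h (SimpleGraph.Walk.cons h' p)) =
      bumpCount (SimpleGraph.Walk.cons h' p) + if z = x then 1 else 0 := by
  have key : ((⟨(x, w), h⟩ : G.Dart) = (⟨(w, z), h'⟩ : G.Dart).symm) ↔ z = x := by
    simp only [SimpleGraph.Dart.ext_iff, SimpleGraph.Dart.symm, Prod.swap, Prod.mk.injEq,
      and_true]
    exact eq_comm
  simp only [bumpCount, SimpleGraph.Walk.darts_cons, List.tail_cons, List.zip_cons_cons,
    List.countP_cons, decide_eq_true_eq, key]

end Walks

/-! ### The three-term recursion for `C_m(t)`. -/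

section PathRecursion

variable {V : Type*} [Fintype V] [DecidableEq V] (G : SimpleGraph V) [DecidableRel G.Adj]

theorem sum_finsetWalkLength_succ (n : ℕ) (x y : V) (f : G.Walk x y → ℂ) :
    ∑ p ∈ G.finsetWalkLength (n + 1) x y, f p =
      ∑ w : V, if h : G.Adj x w then
        ∑ p ∈ G.finsetWalkLength n w y, f (SimpleGraph.Walk.cons h p) else 0 := by
  rw [SimpleGraph.finsetWalkLength, Finset.sum_biUnion]
  · refine Fintype.sum_of_injective Subtype.val Subtype.val_injective _ _ ?_ ?_
    · intro w hw
      rw [dif_neg]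
      intro h
      exact hw ⟨⟨w, h⟩, rfl⟩
    · rintro ⟨w, hw⟩
      have hw' : G.Adj x w := hw
      simp only [hw', dite_true, Finset.sum_map]
      rfl
  · rintro ⟨v, hv⟩ - ⟨w, hw⟩ - hne
    rw [Function.onFun, Finset.disjoint_left]
    intro p hp hp'
    simp only [Finset.mem_map] at hp hp'
    obtain ⟨p₁, -, rfl⟩ := hp
    obtain ⟨p₂, -, h⟩ := hp'
    cases h
    exact hne rfl

/-- The weighted number of walks of length `n + 1` from `x` to `y` whose first step goes to `w`. -/
noncomputable def stepSum (t : ℂ) (n : ℕ) (x w y : V) : ℂ :=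
  if h : G.Adj x w then
    ∑ p ∈ G.finsetWalkLength n w y, t ^ bumpCount (SimpleGraph.Walk.cons h p) else 0

theorem pathOp_succ_apply (t : ℂ) (n : ℕ) (x y : V) :
    pathOp G t (n + 1) x y = ∑ w, stepSum G t n x w y := by
  simp only [pathOp, Matrix.of_apply, sum_finsetWalkLength_succ, stepSum]

theorem pathOp_zero (t : ℂ) : pathOp G t 0 = 1 := by
  ext x y
  by_cases h : x = y
  · subst h
    simp [pathOp, SimpleGraph.finsetWalkLength, bumpCount]
  · simp [pathOp, SimpleGraph.finsetWalkLength, h]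

theorem stepSum_zero (t : ℂ) (x w y : V) :
    stepSum G t 0 x w y = G.adjMatrix ℂ x w * (1 : Matrix V V ℂ) w y := by
  by_cases h : G.Adj x w
  · by_cases hy : w = y
    · subst hy
      simp [stepSum, h, SimpleGraph.finsetWalkLength, bumpCount_cons_nil]
    · simp [stepSum, h, SimpleGraph.finsetWalkLength, hy]
  · simp [stepSum, h]

/-- Prepending `x → w` creates a bump exactly when the next step returns to `x`. Those walks should
carry an extra factor `t = 1 - (1 - t)`, hence the subtracted term. -/
theorem stepSum_succ (t : ℂ) (n : ℕ) (x w y : V) :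
    stepSum G t (n + 1) x w y =
      G.adjMatrix ℂ x w * (pathOp G t (n + 1) w y - (1 - t) * stepSum G t n w x y) := by
  by_cases h : G.Adj x w
  · rw [stepSum, dif_pos h, sum_finsetWalkLength_succ, SimpleGraph.adjMatrix_apply, if_pos h,
      one_mul, pathOp_succ_apply]
    have hz : ∀ z : V, (if h' : G.Adj w z then ∑ p ∈ G.finsetWalkLength n z y,
        t ^ bumpCount (SimpleGraph.Walk.cons h (SimpleGraph.Walk.cons h' p)) else 0) =
        stepSum G t n w z y - if z = x then (1 - t) * stepSum G t n w z y else 0 := by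
      intro z
      by_cases h' : G.Adj w z
      · by_cases hzx : z = x
        · simp only [stepSum, dif_pos h', bumpCount_cons_cons, if_pos hzx, pow_succ,
            ← Finset.sum_mul]
          ring
        · simp [stepSum, h', bumpCount_cons_cons, hzx]
      · simp [stepSum, h']
    simp only [hz, Finset.sum_sub_distrib, Finset.sum_ite_eq', Finset.mem_univ, if_true]
  · simp [stepSum, h]

theorem adjMatrix_mul_stepSum (t : ℂ) (n : ℕ) (x w y : V) :
    G.adjMatrix ℂ x w * stepSum G t n x w y = stepSum G t n x w y := by
  by_cases h : G.Adj x w <;> simp [stepSum, h]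

theorem pathOp_one (t : ℂ) : pathOp G t 1 = G.adjMatrix ℂ := by
  ext x y
  rw [pathOp_succ_apply]
  simp only [stepSum_zero]
  rw [← Matrix.mul_apply, mul_one]

theorem pathOp_add_two_apply (t : ℂ) (n : ℕ) (x y : V) :
    pathOp G t (n + 2) x y = (G.adjMatrix ℂ * pathOp G t (n + 1)) x y
      - (1 - t) * ∑ w, G.adjMatrix ℂ x w * stepSum G t n w x y := by
  rw [pathOp_succ_apply, Matrix.mul_apply, Finset.mul_sum, ← Finset.sum_sub_distrib]
  refine Finset.sum_congr rfl fun w _ => ?_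
  rw [stepSum_succ]
  ring

theorem pathOp_two (t : ℂ) :
    pathOp G t 2 = G.adjMatrix ℂ * G.adjMatrix ℂ - (1 - t) • G.degMatrix ℂ := by
  ext x y
  rw [pathOp_add_two_apply, pathOp_one]
  simp only [stepSum_zero, ← mul_assoc, adjMatrix_sq_apply, ← Finset.sum_mul, sum_adjMatrix_row]
  simp only [Matrix.sub_apply, Matrix.smul_apply, SimpleGraph.degMatrix, smul_eq_mul]
  by_cases h : x = y
  · subst h
    simp
  · simp [h]

/-- Applying `stepSum_succ` once more to the backtracking term and summing over `w` yields `D - (1 -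
t)`, that is `Q(t)`. This needs a further step to expand, so at length 2 the full `D` appears
instead. -/
theorem pathOp_add_three (t : ℂ) (n : ℕ) :
    pathOp G t (n + 3) = G.adjMatrix ℂ * pathOp G t (n + 2)
      - (1 - t) • (Qt G t * pathOp G t (n + 1)) := by
  ext x y
  rw [pathOp_add_two_apply]
  simp only [stepSum_succ, ← mul_assoc, adjMatrix_sq_apply]
  simp only [mul_sub, Finset.sum_sub_distrib, mul_left_comm _ (1 - t), ← Finset.mul_sum,
    adjMatrix_mul_stepSum, ← pathOp_succ_apply, ← Finset.sum_mul, sum_adjMatrix_row]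
  simp only [Matrix.sub_apply, Matrix.smul_apply, smul_eq_mul, Qt, It, SimpleGraph.degMatrix,
    Matrix.sub_mul, Matrix.diagonal_mul, Matrix.smul_mul, Matrix.one_mul]
  ring

end PathRecursion

/-! ### Scalar recursions, power sums and logarithms. -/

section Scalar

/-- The scalar by which `C_m(t)` acts on an eigenvector of the adjacency operator of a
`(q + 1)`-regular graph with eigenvalue `a`. -/
noncomputable def pathCoeff (q : ℕ) (t a : ℂ) : ℕ → ℂ
  | 0 => 1
  | 1 => a
  | 2 => a ^ 2 - (1 - t) * (q + 1)
  | n + 3 => a * pathCoeff q t a (n + 2) - (1 - t) * ((q + t) * pathCoeff q t a (n + 1))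

/-- The scalar by which `C_m^{cbc}(t)`, without the term in `R_m(t)` and uniformly in `m`, acts
on an eigenvector of the adjacency operator with eigenvalue `a`. -/
noncomputable def cbcCoeff (q : ℕ) (t a : ℂ) (m : ℕ) : ℂ :=
  pathCoeff q t a m
    - (1 - t)⁻¹ * (((q : ℂ) + t) - (1 - t)) *
        ∑ j ∈ Finset.Icc 1 ((m + 1) / 2 - 1), (1 - t) ^ (2 * j) * pathCoeff q t a (m - 2 * j)
    - (if Even m then (1 - t) ^ (m - 1) * t * ((q : ℂ) + 1) else 0)

theorem sum_Icc_one_shift (s : ℂ) (c : ℕ → ℂ) (m : ℕ) :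
    ∑ j ∈ Finset.Icc 1 ((m + 3 + 1) / 2 - 1), s ^ (2 * j) * c (m + 3 - 2 * j) =
      s ^ 2 * (∑ j ∈ Finset.Icc 1 ((m + 1 + 1) / 2 - 1), s ^ (2 * j) * c (m + 1 - 2 * j)
        + c (m + 1)) := by
  have h : ∀ (n : ℕ) (f : ℕ → ℂ), ∑ j ∈ Finset.Icc 1 n, f j = ∑ j ∈ Finset.range n, f (j + 1) := by
    intro n f
    induction n with
    | zero => simp
    | succ n ih => rw [Finset.sum_Icc_succ_top (by omega), ih, Finset.sum_range_succ]
  have h1 : (m + 3 + 1) / 2 - 1 = ((m + 1 + 1) / 2 - 1) + 1 := by omega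
  rw [h, h, h1, Finset.sum_range_succ', mul_add (s ^ 2), Finset.mul_sum]
  congr 1
  refine Finset.sum_congr rfl fun j _ => ?_
  rw [show m + 3 - 2 * (j + 1 + 1) = m + 1 - 2 * (j + 1) by omega]
  ring

/-- The correction sum is geometric with ratio `(1 - t)²`, so subtracting `(1 - t)²` times the value
two steps earlier leaves only its `j = 1` term; the parity terms cancel. -/
theorem cbcCoeff_add_three (q : ℕ) {t : ℂ} (ht : t ≠ 1) (a : ℂ) (m : ℕ) :
    cbcCoeff q t a (m + 3) = (1 - t) ^ 2 * cbcCoeff q t a (m + 1)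
      + (pathCoeff q t a (m + 3) - (1 - t) * (q + t) * pathCoeff q t a (m + 1)) := by
  have hs : 1 - t ≠ 0 := sub_ne_zero.mpr ht.symm
  rw [cbcCoeff, cbcCoeff, sum_Icc_one_shift]
  generalize ∑ j ∈ Finset.Icc 1 ((m + 1 + 1) / 2 - 1),
    (1 - t) ^ (2 * j) * pathCoeff q t a (m + 1 - 2 * j) = S
  have he : Even (m + 3) ↔ Even (m + 1) := by
    simp only [Nat.even_add, show Even 3 ↔ Even 1 by decide]
  simp only [he, show m + 3 - 1 = m + 2 by omega, show m + 1 - 1 = m by omega]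
  split_ifs <;> field_simp <;> ring

/-- Both sides satisfy the linear recurrence with characteristic roots `r₁, r₂`, so two initial
values suffice. The `(1 - t)²` comes from the exceptional value at length 2. -/
theorem pathCoeff_sub_eq (q : ℕ) {t a r₁ r₂ : ℂ} (hsum : r₁ + r₂ = a)
    (hprod : r₁ * r₂ = (1 - t) * (q + t)) :
    ∀ m : ℕ, pathCoeff q t a (m + 3) - (1 - t) * (q + t) * pathCoeff q t a (m + 1) =
      r₁ ^ (m + 3) + r₂ ^ (m + 3) - (1 - t) ^ 2 * (r₁ ^ (m + 1) + r₂ ^ (m + 1)) := by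
  have hrec : ∀ n, pathCoeff q t a (n + 3) =
      a * pathCoeff q t a (n + 2) - r₁ * r₂ * pathCoeff q t a (n + 1) := by
    intro n
    rw [pathCoeff, hprod]
    ring
  have h₂ : pathCoeff q t a 2 = a ^ 2 - r₁ * r₂ - (1 - t) ^ 2 := by
    rw [pathCoeff, hprod]
    ring
  have h₁ : pathCoeff q t a 1 = a := rfl
  rw [← hprod]
  subst hsum
  intro m
  induction m using Nat.strong_induction_on with
  | _ m ih =>
    match m with
    | 0 =>
      rw [hrec, zero_add, zero_add, h₂, h₁]
      ring
    | 1 =>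
      rw [hrec, hrec, zero_add, h₂, h₁]
      ring
    | m + 2 =>
      linear_combination (r₁ + r₂) * ih (m + 1) (by omega) - r₁ * r₂ * ih m (by omega)
        + hrec (m + 2) - r₁ * r₂ * hrec m

/-- After removing the power sums of `r₁, r₂`, what remains obeys `x_{m+2} = (1 - t)² x_m` with `x₁
= 0` and `x₂ = (q - 1)(1 - t)²`. -/
theorem cbcCoeff_eq (q : ℕ) {t a r₁ r₂ : ℂ} (ht : t ≠ 1) (hsum : r₁ + r₂ = a)
    (hprod : r₁ * r₂ = (1 - t) * (q + t)) (m : ℕ) :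
    cbcCoeff q t a (m + 1) = r₁ ^ (m + 1) + r₂ ^ (m + 1)
      + ((q : ℂ) - 1) / 2 * ((1 - t) ^ (m + 1) + (-(1 - t)) ^ (m + 1)) := by
  induction m using Nat.strong_induction_on with
  | _ m ih =>
    match m with
    | 0 => simp [cbcCoeff, pathCoeff, hsum]
    | 1 =>
      simp [cbcCoeff, pathCoeff]
      linear_combination 2 * hprod - (r₁ + r₂ + a) * hsum
    | m + 2 =>
      rw [cbcCoeff_add_three q ht, ih m (by omega), pathCoeff_sub_eq q hsum hprod]
      ring

theorem hasSum_pow_add_pow {r₁ r₂ u : ℂ} (h₁ : ‖r₁ * u‖ < 1) (h₂ : ‖r₂ * u‖ < 1) :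
    HasSum (fun m : ℕ => (r₁ ^ (m + 1) + r₂ ^ (m + 1)) / ((m + 1 : ℕ) : ℂ) * u ^ (m + 1))
      (-Complex.log (1 - (r₁ + r₂) * u + r₁ * r₂ * u ^ 2)) := by
  have hre : ∀ z : ℂ, ‖z‖ < 1 → 0 < (1 - z).re := fun z hz => by
    have := (Complex.abs_re_le_norm z).trans_lt hz
    rw [abs_lt] at this
    simp only [Complex.sub_re, Complex.one_re]
    linarith
  have hne : ∀ z : ℂ, ‖z‖ < 1 → 1 - z ≠ 0 := fun z hz h => by
    have := hre z hz
    rw [h] at this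
    simp at this
  have harg : ∀ z : ℂ, ‖z‖ < 1 → |(1 - z).arg| < Real.pi / 2 := fun z hz =>
    Complex.abs_arg_lt_pi_div_two_iff.mpr (Or.inl (hre z hz))
  -- Both factors `1 - rᵢ u` lie in the open right half-plane, so their arguments add without
  -- leaving the principal branch.
  have hlog : Complex.log (1 - (r₁ + r₂) * u + r₁ * r₂ * u ^ 2) =
      Complex.log (1 - r₁ * u) + Complex.log (1 - r₂ * u) := by
    rw [show 1 - (r₁ + r₂) * u + r₁ * r₂ * u ^ 2 = (1 - r₁ * u) * (1 - r₂ * u) by ring]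
    apply Complex.log_mul_eq_add_log_iff (hne _ h₁) (hne _ h₂) |>.mpr
    have a₁ := abs_lt.mp (harg _ h₁)
    have a₂ := abs_lt.mp (harg _ h₂)
    constructor <;> linarith
  rw [hlog, neg_add]
  refine ((Complex.hasSum_taylorSeries_neg_log' h₁).add
    (Complex.hasSum_taylorSeries_neg_log' h₂)).congr_fun ?_
  intro m
  push_cast
  ring

theorem hasSum_cbcCoeff (q : ℕ) {t a u : ℂ} {r : ℝ} (ht : ‖t‖ < 1) (hr : 1 + ‖t‖ ≤ r)
    (hMr : (q : ℝ) + 1 ≤ r)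
    (hquad : r ^ 2 = (q + 1) * r + (‖t‖ + 1) * (q + 1))
    (ha : ‖a‖ ≤ q + 1) (hu : ‖u‖ < 1 / r) :
    HasSum (fun m : ℕ => cbcCoeff q t a (m + 1) / ((m + 1 : ℕ) : ℂ) * u ^ (m + 1))
      (-Complex.log (1 - a * u + (1 - t) * ((q : ℂ) + t) * u ^ 2)
        + -(((q : ℂ) - 1) / 2) * Complex.log (1 - (1 - t) ^ 2 * u ^ 2)) := by
  have ht1 : t ≠ 1 := by
    rintro rfl
    simp at ht
  have hr0 : 0 < r := by linarith [norm_nonneg t]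
  have hur : ∀ z : ℂ, ‖z‖ ≤ r → ‖z * u‖ < 1 := fun z hz => by
    rw [norm_mul]
    calc ‖z‖ * ‖u‖ ≤ r * ‖u‖ := by gcongr
      _ < r * (1 / r) := by gcongr
      _ = 1 := by field_simp
  have hs : ‖1 - t‖ ≤ 1 + ‖t‖ := by simpa using norm_sub_le 1 t
  have hp : ‖(q : ℂ) + t‖ ≤ q + 1 := (norm_add_le _ _).trans (by simpa using ht.le)
  have hroot : ∀ z : ℂ, z ^ 2 - a * z + (1 - t) * (q + t) = 0 → ‖z‖ ≤ r := by
    intro z hz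
    have h1 : z ^ 2 = a * z - (1 - t) * (q + t) := by linear_combination hz
    have h2 : ‖z‖ ^ 2 ≤ (q + 1) * ‖z‖ + (1 + ‖t‖) * (q + 1) := by
      rw [← norm_pow, h1]
      refine (norm_sub_le _ _).trans ?_
      rw [norm_mul, norm_mul]
      gcongr
    -- If `r < ‖z‖`, subtracting `hquad` from `h2` and dividing by `‖z‖ - r` gives `‖z‖ + r ≤ q +
    -- 1`, against `q + 1 ≤ r`.
    by_contra! h
    nlinarith [norm_nonneg z]
  obtain ⟨r₁, hr₁⟩ : ∃ z : ℂ, z ^ 2 - a * z + (1 - t) * (q + t) = 0 := by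
    obtain ⟨d, hd⟩ := IsAlgClosed.exists_pow_nat_eq (a ^ 2 - 4 * ((1 - t) * (q + t)))
      (n := 2) (by norm_num)
    exact ⟨(a + d) / 2, by linear_combination hd / 4⟩
  have hr₂ : (a - r₁) ^ 2 - a * (a - r₁) + (1 - t) * (q + t) = 0 := by
    linear_combination hr₁
  have hprod : r₁ * (a - r₁) = (1 - t) * (q + t) := by linear_combination -hr₁
  have H1 := hasSum_pow_add_pow (hur _ (hroot _ hr₁)) (hur _ (hroot _ hr₂))
  -- The same series with the pair `1 - t`, `-(1 - t)`: sum zero, product `-(1 - t)²`.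
  have H2 := (hasSum_pow_add_pow (hur _ (hs.trans hr))
    (hur (-(1 - t)) (by rw [norm_neg]; exact hs.trans hr))).mul_left (((q : ℂ) - 1) / 2)
  convert H1.add H2 using 1
  · ext m
    rw [cbcCoeff_eq q ht1 (add_sub_cancel r₁ a) hprod]
    ring
  · rw [hprod, add_sub_cancel]
    ring_nf

theorem norm_pathCoeff_le (q : ℕ) {t a : ℂ} {r : ℝ} (ht : ‖t‖ < 1) (hMr : (q : ℝ) + 1 ≤ r)
    (hquad : r ^ 2 = (q + 1) * r + (‖t‖ + 1) * (q + 1)) (ha : ‖a‖ ≤ q + 1) :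
    ∀ m : ℕ, ‖pathCoeff q t a m‖ ≤ r ^ m := by
  have hs : ‖1 - t‖ ≤ ‖t‖ + 1 := by simpa [add_comm] using norm_sub_le 1 t
  have hp : ‖(q : ℂ) + t‖ ≤ q + 1 := (norm_add_le _ _).trans (by simpa using ht.le)
  have hr0 : 0 ≤ r := by linarith [(Nat.cast_nonneg q : (0 : ℝ) ≤ q)]
  intro m
  induction m using Nat.strong_induction_on with
  | _ m ih =>
    match m with
    | 0 => simp [pathCoeff]
    | 1 => simpa [pathCoeff] using ha.trans hMr
    | 2 =>
      rw [pathCoeff, hquad]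
      refine (norm_sub_le _ _).trans ?_
      rw [sq, norm_mul, norm_mul]
      have : ‖(q : ℂ) + 1‖ = q + 1 := by exact_mod_cast Complex.norm_natCast (q + 1)
      rw [this]
      gcongr
      exact ha.trans hMr
    | m + 3 =>
      rw [pathCoeff, show r ^ (m + 3) = (q + 1) * r ^ (m + 2) + (‖t‖ + 1) * ((q + 1) * r ^ (m + 1))
        by linear_combination r ^ (m + 1) * hquad]
      refine (norm_sub_le _ _).trans ?_
      rw [norm_mul, norm_mul, norm_mul]
      have h2 := ih (m + 2) (by omega)
      have h1 := ih (m + 1) (by omega)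
      gcongr

end Scalar

/-! ### Spectral decomposition and local multiplicities. -/

section Spectral

variable {V : Type*} [Fintype V] [DecidableEq V] (G : SimpleGraph V) [DecidableRel G.Adj]

theorem laplacian_isSymmetric : (laplacian G).IsSymmetric :=
  Matrix.isSymmetric_toEuclideanLin_iff.mpr (G.isHermitian_lapMatrix ℝ)

theorem sum_primIdempotent (v : EuclideanSpace ℝ V) :
    ∑ μ ∈ (laplacian G).finite_hasEigenvalue.toFinset, primIdempotent G μ v = v := by
  have hT := laplacian_isSymmetric G
  have h := hT.orthogonalFamily_eigenspaces'.sum_projection_of_mem_iSup v (by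
    rw [Submodule.orthogonal_eq_bot_iff.mp hT.orthogonalComplement_iSup_eigenspaces_eq_bot']
    exact Submodule.mem_top)
  refine Eq.trans ?_ h
  exact Finset.sum_subtype (p := fun μ => (laplacian G).HasEigenvalue μ) _ (by simp)
    (fun μ => primIdempotent G μ v)

theorem localMult_eq_norm_sq (x : V) (μ : ℝ) :
    localMult G x μ = ‖primIdempotent G μ (EuclideanSpace.single x 1)‖ ^ 2 := by
  have h := Submodule.inner_starProjection_left_eq_right
    (Module.End.eigenspace (laplacian G) μ) (EuclideanSpace.single x (1 : ℝ))
    (primIdempotent G μ (EuclideanSpace.single x 1))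
  have h' : primIdempotent G μ (primIdempotent G μ (EuclideanSpace.single x 1)) =
      primIdempotent G μ (EuclideanSpace.single x 1) :=
    Submodule.starProjection_eq_self_iff.mpr (Submodule.starProjection_apply_mem _ _)
  rw [← real_inner_self_eq_norm_sq]
  change inner ℝ (primIdempotent G μ _) _ = inner ℝ _ (primIdempotent G μ _) at h
  rw [h, h', EuclideanSpace.inner_single_left]
  simp [localMult, crossedMult]

/-- Since the local multiplicity is `‖E_μ δ_{x₀}‖²`, its failing to be positive kills the whole
vector `E_μ δ_{x₀}`. Hence restricting to the `x₀`-local spectrum loses nothing for any `x`. -/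
theorem crossedMult_eq_zero_of_not_pos {x₀ : V} {μ : ℝ} (h : ¬ 0 < localMult G x₀ μ) (x : V) :
    crossedMult G x₀ x μ = 0 := by
  rw [localMult_eq_norm_sq] at h
  have h0 : primIdempotent G μ (EuclideanSpace.single x₀ 1) = 0 := by
    by_contra hne
    exact h (by positivity)
  simp [crossedMult, h0]

theorem sum_crossedMult (x₀ x : V) :
    ∑ μ ∈ localSpectrum G x₀, crossedMult G x₀ x μ = if x = x₀ then 1 else 0 := by
  have h := congrArg (fun v : EuclideanSpace ℝ V => v x)
    (sum_primIdempotent G (EuclideanSpace.single x₀ 1))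
  simp only [WithLp.ofLp_sum, Finset.sum_apply, PiLp.single_apply] at h
  rw [← h, localSpectrum, Finset.sum_filter_of_ne]
  · rfl
  · intro μ _ hne
    by_contra hpos
    exact hne (crossedMult_eq_zero_of_not_pos G hpos x)

variable {G} {q : ℕ} (hG : G.IsRegularOfDegree (q + 1))
include hG

theorem adjMatrix_mulVec_of_laplacian {v : EuclideanSpace ℝ V} {μ : ℝ}
    (hv : laplacian G v = μ • v) (x : V) :
    ∑ y ∈ G.neighborFinset x, v y = ((q : ℝ) + 1 - μ) * v x := by
  have h := congrArg (fun w : EuclideanSpace ℝ V => w x) hv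
  simp only [laplacian, Matrix.ofLp_toLpLin, Matrix.toLin'_apply, SimpleGraph.lapMatrix_mulVec_apply,
    hG.degree_eq, PiLp.smul_apply, smul_eq_mul] at h
  push_cast at h
  linear_combination -h

/-- Maximum principle: evaluate the eigenvalue equation at a vertex where `|v|` is largest. -/
theorem abs_sub_eigenvalue_le {v : EuclideanSpace ℝ V} {μ : ℝ} (hv : laplacian G v = μ • v)
    (hv0 : v ≠ 0) : |(q : ℝ) + 1 - μ| ≤ q + 1 := by
  obtain ⟨z, hz⟩ : ∃ z, v z ≠ 0 := by
    by_contra! h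
    exact hv0 (by ext z; simpa using h z)
  obtain ⟨x, -, hx⟩ := Finset.exists_max_image Finset.univ (fun y => |v y|) ⟨z, Finset.mem_univ z⟩
  have hx0 : 0 < |v x| := (abs_pos.mpr hz).trans_le (hx z (Finset.mem_univ z))
  refine le_of_mul_le_mul_right ?_ hx0
  rw [← abs_mul, ← adjMatrix_mulVec_of_laplacian hG hv]
  calc |∑ y ∈ G.neighborFinset x, v y| ≤ ∑ y ∈ G.neighborFinset x, |v y| :=
        Finset.abs_sum_le_sum_abs _ _
    _ ≤ ∑ y ∈ G.neighborFinset x, |v x| :=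
        Finset.sum_le_sum fun y _ => hx y (Finset.mem_univ y)
    _ = (q + 1) * |v x| := by simp [hG.degree_eq]

omit hG in
theorem laplacian_primIdempotent (μ : ℝ) (v : EuclideanSpace ℝ V) :
    laplacian G (primIdempotent G μ v) = μ • primIdempotent G μ v :=
  Module.End.mem_eigenspace_iff.mp (Submodule.starProjection_apply_mem _ _)

theorem abs_sub_le_of_mem_localSpectrum {x₀ : V} {μ : ℝ} (hμ : μ ∈ localSpectrum G x₀) :
    |(q : ℝ) + 1 - μ| ≤ q + 1 := by
  refine abs_sub_eigenvalue_le hG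
    (laplacian_primIdempotent μ (EuclideanSpace.single x₀ 1)) fun h0 => ?_
  have := (Finset.mem_filter.mp hμ).2
  rw [localMult_eq_norm_sq, h0] at this
  simp at this

theorem adjMatrix_mulVec_crossedMult (x₀ : V) (μ : ℝ) :
    (G.adjMatrix ℂ).mulVec (fun x => (crossedMult G x₀ x μ : ℂ)) =
      ((q : ℂ) + 1 - μ) • fun x => (crossedMult G x₀ x μ : ℂ) := by
  ext x
  rw [SimpleGraph.adjMatrix_mulVec_apply]
  have h := adjMatrix_mulVec_of_laplacian hG
    (laplacian_primIdempotent μ (EuclideanSpace.single x₀ 1)) x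
  simp only [Pi.smul_apply, smul_eq_mul]
  exact_mod_cast congrArg (fun r : ℝ => (r : ℂ)) h

theorem degMatrix_eq_smul : G.degMatrix ℂ = ((q : ℂ) + 1) • (1 : Matrix V V ℂ) := by
  ext x y
  by_cases h : x = y
  · subst h
    simp [SimpleGraph.degMatrix, hG.degree_eq]
  · simp [SimpleGraph.degMatrix, h]

theorem Qt_eq_smul (t : ℂ) : Qt G t = ((q : ℂ) + t) • (1 : Matrix V V ℂ) := by
  rw [Qt, It, degMatrix_eq_smul hG, ← sub_smul]
  congr 1
  ring

theorem pathOp_mulVec_eq {v : V → ℂ} {a : ℂ} (hv : (G.adjMatrix ℂ).mulVec v = a • v) (t : ℂ) :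
    ∀ m : ℕ, (pathOp G t m).mulVec v = pathCoeff q t a m • v := by
  intro m
  induction m using Nat.strong_induction_on with
  | _ m ih =>
    match m with
    | 0 => simp [pathOp_zero, pathCoeff]
    | 1 => rw [pathOp_one, hv, pathCoeff]
    | 2 =>
      rw [pathOp_two, pathCoeff, degMatrix_eq_smul hG, Matrix.sub_mulVec, ← Matrix.mulVec_mulVec,
        hv, Matrix.mulVec_smul, hv]
      simp only [Matrix.smul_mulVec, Matrix.one_mulVec, smul_smul, ← sub_smul]
      congr 1
      ring
    | m + 3 =>
      rw [pathOp_add_three, pathCoeff, Qt_eq_smul hG, Matrix.sub_mulVec, ← Matrix.mulVec_mulVec,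
        ih _ (by omega), Matrix.mulVec_smul, hv]
      simp only [Matrix.smul_mulVec, Matrix.smul_mul, Matrix.one_mul, ih (m + 1) (by omega),
        smul_smul, ← sub_smul]
      congr 1
      ring

omit hG in
theorem kernel_eq_sum {B : Matrix V V ℂ} {b : ℝ → ℂ} {x₀ : V}
    (hB : ∀ μ ∈ localSpectrum G x₀, B.mulVec (fun x => (crossedMult G x₀ x μ : ℂ)) =
      b μ • fun x => (crossedMult G x₀ x μ : ℂ)) (x : V) :
    kernel B x₀ x = ∑ μ ∈ localSpectrum G x₀, (crossedMult G x₀ x μ : ℂ) * b μ := by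
  have hδ : (Pi.single x₀ 1 : V → ℂ) =
      ∑ μ ∈ localSpectrum G x₀, fun x => (crossedMult G x₀ x μ : ℂ) := by
    ext y
    rw [Finset.sum_apply, ← Complex.ofReal_sum, sum_crossedMult, Pi.single_apply]
    split_ifs <;> simp
  rw [kernel, hδ, Matrix.mulVec_sum, Finset.sum_apply]
  refine Finset.sum_congr rfl fun μ hμ => ?_
  rw [hB μ hμ, Pi.smul_apply, smul_eq_mul, mul_comm]

theorem kernel_pathOp (t : ℂ) (m : ℕ) (x₀ x : V) :
    kernel (pathOp G t m) x₀ x = ∑ μ ∈ localSpectrum G x₀,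
      (crossedMult G x₀ x μ : ℂ) * pathCoeff q t ((q : ℂ) + 1 - μ) m :=
  kernel_eq_sum (fun μ _ => pathOp_mulVec_eq hG (adjMatrix_mulVec_crossedMult hG x₀ μ) t m) x

omit hG in
theorem Rcoeff_of_le_two (t : ℂ) {m : ℕ} (hm : m ≤ 2) (x : V) : Rcoeff G t m x = 0 := by
  rw [Rcoeff, Finset.Icc_eq_empty (by omega), Finset.sum_empty]

/-- `C_m^{cbc}(t)` without the term in `R_m(t)`, given by the same formula for all `m`. -/
noncomputable def cbcMainOp {V : Type*} [Fintype V] [DecidableEq V] (G : SimpleGraph V)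
    [DecidableRel G.Adj] (t : ℂ) (m : ℕ) : Matrix V V ℂ :=
  pathOp G t m
    - ((1 - t)⁻¹ • (Qt G t - It t)) *
        ∑ j ∈ Finset.Icc 1 ((m + 1) / 2 - 1), (1 - t) ^ (2 * j) • pathOp G t (m - 2 * j)
    - (if Even m then ((1 - t) ^ (m - 1) * t) • G.degMatrix ℂ else 0)

-- Isolates the defect at `m = 2`: there `t C₂ - (C₂ - (1 - t) t D) = (1 - t)(t D - C₂)`.
omit hG in
theorem cbcOp_succ (t : ℂ) (m : ℕ) :
    cbcOp G t (m + 1) = cbcMainOp G t (m + 1)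
      + (if m = 1 then (1 - t) • (t • G.degMatrix ℂ - pathOp G t 2) else 0)
      + (1 - t) • Rop G t (m + 1) := by
  have hR : ∀ n ≤ 2, Rop G t n = 0 := fun n hn => by
    rw [Rop, funext (Rcoeff_of_le_two t hn)]
    exact Matrix.diagonal_zero
  match m with
  | 0 => simp [cbcOp, cbcMainOp, hR]
  | 1 =>
    simp only [cbcOp, cbcMainOp, hR 2 le_rfl, Nat.reduceAdd]
    simp only [Nat.reduceLeDiff, if_true, if_false, even_two, Nat.reduceDiv,
      Nat.reduceSub, show Finset.Icc 1 0 = (∅ : Finset ℕ) from rfl, Finset.sum_empty, mul_zero,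
      pow_one]
    module
  | m + 2 =>
    rw [cbcOp, if_neg (by omega), if_neg (by omega), if_neg (show ¬ m + 2 = 1 by omega), cbcMainOp]
    abel

theorem cbcMainOp_mulVec_eq {v : V → ℂ} {a : ℂ} (hv : (G.adjMatrix ℂ).mulVec v = a • v) (t : ℂ)
    (m : ℕ) : (cbcMainOp G t m).mulVec v = cbcCoeff q t a m • v := by
  rw [cbcMainOp, cbcCoeff, Qt_eq_smul hG, degMatrix_eq_smul hG, It, ← sub_smul, smul_smul,
    Matrix.smul_mul, Matrix.one_mul, Matrix.sub_mulVec, Matrix.sub_mulVec, Matrix.smul_mulVec,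
    Matrix.sum_mulVec, pathOp_mulVec_eq hG hv, sub_smul (_ - _), sub_smul,
    mul_smul _ (Finset.sum _ _), Finset.sum_smul]
  congr 1
  · simp only [Matrix.smul_mulVec, pathOp_mulVec_eq hG hv, smul_smul]
  · split_ifs <;> simp [Matrix.smul_mulVec, smul_smul]

theorem kernel_cbcOp_succ (t : ℂ) (m : ℕ) (x₀ x : V) :
    kernel (cbcOp G t (m + 1)) x₀ x =
      ∑ μ ∈ localSpectrum G x₀,
          (crossedMult G x₀ x μ : ℂ) * cbcCoeff q t ((q : ℂ) + 1 - μ) (m + 1)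
        + (if m = 1 then (1 - t) * kernel (t • G.degMatrix ℂ - pathOp G t 2) x₀ x else 0)
        + (1 - t) * kernel (Rop G t (m + 1)) x₀ x := by
  rw [← kernel_eq_sum (B := cbcMainOp G t (m + 1))
    (fun μ _ => cbcMainOp_mulVec_eq hG (adjMatrix_mulVec_crossedMult hG x₀ μ) t (m + 1)),
    cbcOp_succ]
  simp only [kernel, Matrix.add_mulVec, Matrix.smul_mulVec, Pi.add_apply]
  split_ifs <;> simp

end Spectral

/-! ### Bounds by `α(t)`, summability and the product formula. -/

section Convergence

variable {V : Type*} [Fintype V] [DecidableEq V] {G : SimpleGraph V} [DecidableRel G.Adj]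

omit [DecidableEq V] in
theorem alpha_sq (t : ℂ) :
    alpha G t ^ 2 = G.maxDegree * alpha G t + (‖t‖ + 1) * G.maxDegree := by
  have h : 0 ≤ (G.maxDegree : ℝ) ^ 2 + 4 * (‖t‖ + 1) * (G.maxDegree : ℝ) := by positivity
  rw [alpha]
  linear_combination Real.sq_sqrt h / 4

omit [DecidableEq V] in
theorem maxDegree_le_alpha (t : ℂ) : (G.maxDegree : ℝ) ≤ alpha G t := by
  have h : (G.maxDegree : ℝ) ≤
      Real.sqrt ((G.maxDegree : ℝ) ^ 2 + 4 * (‖t‖ + 1) * (G.maxDegree : ℝ)) := by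
    apply Real.le_sqrt_of_sq_le
    have : 0 ≤ 4 * (‖t‖ + 1) * (G.maxDegree : ℝ) := by positivity
    linarith
  rw [alpha]
  linarith

-- At `r = 1 + |t|` the polynomial `r² - M r - (|t| + 1) M` equals `(1 + |t|)(1 + |t| - 2M) ≤ 0`, so
-- its positive root `α(t)` is at least `1 + |t|`.
omit [DecidableEq V] in
theorem one_add_norm_le_alpha {t : ℂ} (ht : ‖t‖ < 1) (hG : 1 ≤ G.maxDegree) :
    1 + ‖t‖ ≤ alpha G t := by
  have h1 : (1 : ℝ) ≤ G.maxDegree := by exact_mod_cast hG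
  have h2 := alpha_sq (G := G) t
  have h3 := maxDegree_le_alpha (G := G) t
  have h0 := norm_nonneg t
  by_contra! h
  nlinarith [mul_le_mul_of_nonneg_right h1 (by linarith : 0 ≤ alpha G t + ‖t‖ + 1)]

/-- There are at most `m²` index pairs, and each summand is of order `rᵐ` because `|1 - t| ≤ r` and
`|1 - t²| ≤ r²`. -/
theorem norm_Rcoeff_le {t : ℂ} {r : ℝ} (hr : 1 + ‖t‖ ≤ r) {K : V → ℝ}
    (hK : ∀ m y, ‖kernel (pathOp G t m) y y‖ ≤ K y * r ^ m) (m : ℕ) (x : V) :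
    ‖Rcoeff G t m x‖ ≤ m ^ 2 * ((∑ y, ‖G.lapMatrix ℂ x y‖ * K y) * r ^ m) := by
  have h0 := norm_nonneg t
  have hs : ‖1 - t‖ ≤ r := by
    refine (norm_sub_le _ _).trans ?_
    simpa using hr
  have hs2 : ‖1 - t ^ 2‖ ≤ r ^ 2 := by
    refine (norm_sub_le _ _).trans ?_
    rw [norm_pow, norm_one]
    nlinarith
  have hr1 : 1 ≤ r := by linarith
  have hK0 : ∀ y, 0 ≤ K y := fun y => by
    simpa using (norm_nonneg _).trans (hK 0 y)
  set S := ∑ y, ‖G.lapMatrix ℂ x y‖ * K y with hS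
  have hS0 : 0 ≤ S := Finset.sum_nonneg fun y _ => mul_nonneg (norm_nonneg _) (hK0 y)
  have hL : ∀ n, ‖(G.lapMatrix ℂ).mulVec (fun y => kernel (pathOp G t n) y y) x‖ ≤ S * r ^ n := by
    intro n
    rw [Matrix.mulVec, dotProduct, hS, Finset.sum_mul]
    refine (norm_sum_le _ _).trans (Finset.sum_le_sum fun y _ => ?_)
    rw [norm_mul, mul_assoc]
    gcongr
    exact hK n y
  have hterm : ∀ j ∈ Finset.Icc 1 ((m + 1) / 2 - 1), ∀ i ∈ Finset.Icc 1 j,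
      ‖(1 - t) ^ (2 * (j - i)) * (1 - t ^ 2) ^ (i - 1) *
        (G.lapMatrix ℂ).mulVec (fun y => kernel (pathOp G t (m - 2 * j)) y y) x‖ ≤ S * r ^ m := by
    intro j hj i hi
    rw [Finset.mem_Icc] at hj hi
    rw [norm_mul, norm_mul, norm_pow, norm_pow]
    calc ‖1 - t‖ ^ (2 * (j - i)) * ‖1 - t ^ 2‖ ^ (i - 1) * ‖_‖
        ≤ r ^ (2 * (j - i)) * (r ^ 2) ^ (i - 1) * (S * r ^ (m - 2 * j)) := by
          gcongr
          exact hL _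
      _ = S * r ^ (2 * (j - i) + 2 * (i - 1) + (m - 2 * j)) := by ring
      -- The exponents add up to `m - 2`, and `r ≥ 1`.
      _ ≤ S * r ^ m := by
          gcongr
          omega
  rw [Rcoeff]
  calc ‖_‖ ≤ ∑ j ∈ Finset.Icc 1 ((m + 1) / 2 - 1), ∑ i ∈ Finset.Icc 1 j, S * r ^ m :=
        norm_sum_le_of_le _ fun j hj => norm_sum_le_of_le _ (hterm j hj)
    _ ≤ ∑ j ∈ Finset.Icc 1 ((m + 1) / 2 - 1), m * (S * r ^ m) := by
        refine Finset.sum_le_sum fun j hj => ?_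
        rw [Finset.mem_Icc] at hj
        rw [Finset.sum_const, nsmul_eq_mul, Nat.card_Icc]
        gcongr
        omega
    _ ≤ m ^ 2 * (S * r ^ m) := by
        rw [Finset.sum_const, nsmul_eq_mul, Nat.card_Icc, sq, mul_assoc (m : ℝ)]
        gcongr
        omega

theorem summable_RTerm {t u : ℂ} {r : ℝ} (hr : 1 + ‖t‖ ≤ r) (hu : ‖u‖ < 1 / r) {K : V → ℝ}
    (hK : ∀ m y, ‖kernel (pathOp G t m) y y‖ ≤ K y * r ^ m) (x₀ x : V) :
    Summable (RTerm G u t x₀ x) := by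
  have hr0 : 0 < r := by linarith [norm_nonneg t]
  have hρ : ‖r * ‖u‖‖ < 1 := by
    rw [Real.norm_of_nonneg (by positivity)]
    calc r * ‖u‖ < r * (1 / r) := by gcongr
      _ = 1 := by field_simp
  have hK0 : ∀ y, 0 ≤ K y := fun y => by
    simpa using (norm_nonneg _).trans (hK 0 y)
  set S := ∑ y, ‖G.lapMatrix ℂ x₀ y‖ * K y with hS
  have hS0 : 0 ≤ S := Finset.sum_nonneg fun y _ => mul_nonneg (norm_nonneg _) (hK0 y)
  refine Summable.of_norm_bounded
    ((summable_pow_mul_geometric_of_norm_lt_one 2 hρ).mul_left (‖1 - t‖ * S)) fun m => ?_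
  have hk : ‖kernel (Rop G t m) x₀ x‖ ≤ m ^ 2 * (S * r ^ m) := by
    have h := norm_Rcoeff_le hr hK m x₀
    rw [kernel, Rop, Matrix.mulVec_diagonal, Pi.single_apply]
    split_ifs with hx
    · rw [mul_one, hx]
      exact h
    · rw [mul_zero, norm_zero]
      positivity
  -- This includes `m = 0`, where the inverse is `0`.
  have hm : ‖(m : ℂ)⁻¹‖ ≤ 1 := by
    rw [norm_inv, Complex.norm_natCast]
    exact Nat.cast_inv_le_one m
  rw [RTerm, norm_mul, norm_pow, div_eq_mul_inv, norm_mul, norm_mul]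
  calc ‖1 - t‖ * ‖kernel (Rop G t m) x₀ x‖ * ‖(m : ℂ)⁻¹‖ * ‖u‖ ^ m
      ≤ ‖1 - t‖ * (m ^ 2 * (S * r ^ m)) * 1 * ‖u‖ ^ m := by gcongr
    _ = ‖1 - t‖ * S * ((m : ℝ) ^ 2 * (r * ‖u‖) ^ m) := by ring

variable {q : ℕ} (hG : G.IsRegularOfDegree (q + 1))
include hG

theorem norm_sub_eigenvalue_le {x₀ : V} {μ : ℝ} (hμ : μ ∈ localSpectrum G x₀) :
    ‖(q : ℂ) + 1 - μ‖ ≤ q + 1 := by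
  have h := abs_sub_le_of_mem_localSpectrum hG hμ
  rw [← Real.norm_eq_abs, ← Complex.norm_real] at h
  exact_mod_cast h

theorem norm_kernel_pathOp_le {t : ℂ} {r : ℝ} (ht : ‖t‖ < 1) (hMr : (q : ℝ) + 1 ≤ r)
    (hquad : r ^ 2 = (q + 1) * r + (‖t‖ + 1) * (q + 1)) (m : ℕ) (x₀ x : V) :
    ‖kernel (pathOp G t m) x₀ x‖ ≤ (∑ μ ∈ localSpectrum G x₀, |crossedMult G x₀ x μ|) * r ^ m := by
  rw [kernel_pathOp hG, Finset.sum_mul]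
  refine norm_sum_le_of_le _ fun μ hμ => ?_
  rw [norm_mul, Complex.norm_real, Real.norm_eq_abs]
  gcongr
  exact norm_pathCoeff_le q ht hMr hquad (norm_sub_eigenvalue_le hG hμ) m

theorem hasSum_zetaTerm {u t : ℂ} {r : ℝ} (ht : ‖t‖ < 1) (hr : 1 + ‖t‖ ≤ r)
    (hMr : (q : ℝ) + 1 ≤ r) (hquad : r ^ 2 = (q + 1) * r + (‖t‖ + 1) * (q + 1))
    (hu : ‖u‖ < 1 / r) (x₀ x : V) :
    HasSum (fun m : ℕ => zetaTerm G u t x₀ x (m + 1))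
      (∑ μ ∈ localSpectrum G x₀, (crossedMult G x₀ x μ : ℂ) *
          (-Complex.log (localFactor q u t μ)
            + -(((q : ℂ) - 1) / 2) * Complex.log (1 - (1 - t) ^ 2 * u ^ 2))
        + kernel (t • G.degMatrix ℂ - pathOp G t 2) x₀ x / 2 * (1 - t) * u ^ 2
        + ∑' m : ℕ, RTerm G u t x₀ x (m + 3)) := by
  have hR : HasSum (fun m : ℕ => RTerm G u t x₀ x (m + 1)) (∑' m : ℕ, RTerm G u t x₀ x (m + 3)) := by
    have hs := summable_RTerm hr hu
      (fun m y => norm_kernel_pathOp_le hG ht hMr hquad m y y) x₀ x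
    have h0 : ∀ n ≤ 2, RTerm G u t x₀ x n = 0 := fun n hn => by
      rw [RTerm, Rop, funext (Rcoeff_of_le_two t hn)]
      simp [kernel]
    -- `R₁` and `R₂` vanish, so the series starting at `m = 3` and at `m = 1` have the same sum.
    rw [← hasSum_nat_add_iff' 2]
    simpa [Finset.sum_range_succ, h0] using ((summable_nat_add_iff 3).mpr hs).hasSum
  have hC : HasSum (fun m : ℕ => if m = 1 then
      kernel (t • G.degMatrix ℂ - pathOp G t 2) x₀ x / 2 * (1 - t) * u ^ 2 else 0) _ :=
    hasSum_ite_eq 1 _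
  have hM := hasSum_sum (s := localSpectrum G x₀) fun μ hμ =>
    (hasSum_cbcCoeff q ht hr hMr hquad (norm_sub_eigenvalue_le hG hμ) hu).mul_left
      (crossedMult G x₀ x μ : ℂ)
  refine ((hM.add hC).add hR).congr_fun fun m => ?_
  rw [zetaTerm, kernel_cbcOp_succ hG, RTerm, add_div, add_div, add_mul, add_mul, Finset.sum_div,
    Finset.sum_mul]
  congr 2
  · refine Finset.sum_congr rfl fun μ _ => ?_
    ring
  · split_ifs with hm
    · subst hm
      push_cast
      ring
    · simp

theorem localFactor_ne_zero {u t : ℂ} {r : ℝ} (ht : ‖t‖ < 1) (hr : 0 < r)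
    (hquad : r ^ 2 = (q + 1) * r + (‖t‖ + 1) * (q + 1))
    (hu : ‖u‖ < 1 / r) {x₀ : V} {μ : ℝ} (hμ : μ ∈ localSpectrum G x₀) :
    localFactor q u t μ ≠ 0 := by
  intro h
  have ha := norm_sub_eigenvalue_le hG hμ
  have hs : ‖1 - t‖ ≤ ‖t‖ + 1 := by simpa [add_comm] using norm_sub_le 1 t
  have hp : ‖(q : ℂ) + t‖ ≤ q + 1 := (norm_add_le _ _).trans (by simpa using ht.le)
  have h1 : (1 : ℂ) = ((q : ℂ) + 1 - μ) * u - (1 - t) * (q + t) * u ^ 2 := by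
    rw [localFactor] at h
    linear_combination h
  have h2 : (1 : ℝ) ≤ (q + 1) * ‖u‖ + (‖t‖ + 1) * (q + 1) * ‖u‖ ^ 2 := by
    calc (1 : ℝ) = ‖(1 : ℂ)‖ := norm_one.symm
      _ ≤ _ := by
        rw [h1]
        refine (norm_sub_le _ _).trans ?_
        rw [norm_mul, norm_mul, norm_mul, norm_pow]
        gcongr
  have h3 : (q + 1) * ‖u‖ + (‖t‖ + 1) * (q + 1) * ‖u‖ ^ 2 <
      (q + 1) * (1 / r) + (‖t‖ + 1) * (q + 1) * (1 / r) ^ 2 := by gcongr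
  -- This is `hquad` divided by `r²`.
  have h4 : (q + 1) * (1 / r) + (‖t‖ + 1) * (q + 1) * (1 / r) ^ 2 = 1 := by
    field_simp
    linear_combination -hquad
  linarith

omit hG in
theorem one_sub_sq_ne_zero {u t : ℂ} {r : ℝ} (hr : 1 + ‖t‖ ≤ r) (hu : ‖u‖ < 1 / r) :
    1 - (1 - t) ^ 2 * u ^ 2 ≠ 0 := by
  have hr0 : 0 < r := by linarith [norm_nonneg t]
  have hs : ‖1 - t‖ ≤ 1 + ‖t‖ := by simpa using norm_sub_le 1 t
  have h : ‖(1 - t) * u‖ < 1 := by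
    rw [norm_mul]
    calc ‖1 - t‖ * ‖u‖ ≤ r * ‖u‖ := by gcongr; exact hs.trans hr
      _ < r * (1 / r) := by gcongr
      _ = 1 := by field_simp
  intro h0
  have h1 : ((1 - t) * u) ^ 2 = 1 := by linear_combination -h0
  have h2 : ‖(1 - t) * u‖ ^ 2 = 1 := by rw [← norm_pow, h1, norm_one]
  nlinarith [norm_nonneg ((1 - t) * u)]

theorem bartholdiZeta_eq {u t : ℂ} {r : ℝ} (ht : ‖t‖ < 1) (hr : 1 + ‖t‖ ≤ r)
    (hMr : (q : ℝ) + 1 ≤ r) (hquad : r ^ 2 = (q + 1) * r + (‖t‖ + 1) * (q + 1))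
    (hu : ‖u‖ < 1 / r) (x₀ x : V) :
    bartholdiZeta G u t x₀ x =
      (1 - (1 - t) ^ 2 * u ^ 2) ^ (-(((q : ℂ) - 1) / 2) * (if x = x₀ then 1 else 0)) *
      (∏ μ ∈ localSpectrum G x₀, localFactor q u t μ ^ (-(crossedMult G x₀ x μ : ℂ))) *
      Complex.exp
        (kernel (t • G.degMatrix ℂ - pathOp G t 2) x₀ x / 2 * (1 - t) * u ^ 2) *
      Complex.exp (∑' m : ℕ, RTerm G u t x₀ x (m + 3)) := by
  have hr0 : 0 < r := by linarith [norm_nonneg t]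
  have hprod : ∏ μ ∈ localSpectrum G x₀, localFactor q u t μ ^ (-(crossedMult G x₀ x μ : ℂ)) =
      Complex.exp (∑ μ ∈ localSpectrum G x₀,
        Complex.log (localFactor q u t μ) * -(crossedMult G x₀ x μ : ℂ)) := by
    rw [Complex.exp_sum]
    exact Finset.prod_congr rfl fun μ hμ =>
      Complex.cpow_def_of_ne_zero (localFactor_ne_zero hG ht hr0 hquad hu hμ) _
  have hsum : ((if x = x₀ then 1 else 0 : ℝ) : ℂ) = if x = x₀ then 1 else 0 := by
    split_ifs <;> simp
  -- The exponent `δ_{x₀}(x)` is rewritten as the sum of crossed multiplicities, so that both kinds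
  -- of logarithm are sums over the local spectrum and match termwise.
  rw [bartholdiZeta, (hasSum_zetaTerm hG ht hr hMr hquad hu x₀ x).tsum_eq, hprod,
    Complex.cpow_def_of_ne_zero (one_sub_sq_ne_zero hr hu), ← Complex.exp_add, ← Complex.exp_add,
    ← Complex.exp_add, ← hsum, ← sum_crossedMult G x₀ x]
  congr 3
  rw [Complex.ofReal_sum]
  simp only [mul_add, Finset.sum_add_distrib, Finset.mul_sum]
  rw [add_comm]
  congr 1 <;> refine Finset.sum_congr rfl fun μ _ => ?_ <;> ring

end Convergence

end BartholdiZeta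

theorem corollary4p6 {V : Type*} [Fintype V] [DecidableEq V]
    (G : SimpleGraph V) [DecidableRel G.Adj] (q : ℕ) (hG : G.IsRegularOfDegree (q + 1))
    (u t : ℂ) (ht : ‖t‖ < 1) (hu : ‖u‖ < 1 / BartholdiZeta.alpha G t) (x₀ : V) :
    (∀ x : V,
      Summable (fun m : ℕ => BartholdiZeta.zetaTerm G u t x₀ x (m + 1)) ∧
      Summable (fun m : ℕ => BartholdiZeta.RTerm G u t x₀ x (m + 3)) ∧
      BartholdiZeta.bartholdiZeta G u t x₀ x =
        (1 - (1 - t) ^ 2 * u ^ 2) ^ (-(((q : ℂ) - 1) / 2) * (if x = x₀ then 1 else 0)) *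
        (∏ μ ∈ BartholdiZeta.localSpectrum G x₀,
          BartholdiZeta.localFactor q u t μ ^ (-(BartholdiZeta.crossedMult G x₀ x μ : ℂ))) *
        Complex.exp
          (BartholdiZeta.kernel (t • G.degMatrix ℂ - BartholdiZeta.pathOp G t 2) x₀ x / 2 *
            (1 - t) * u ^ 2) *
        Complex.exp (∑' m : ℕ, BartholdiZeta.RTerm G u t x₀ x (m + 3))) ∧
    BartholdiZeta.bartholdiZeta G u t x₀ x₀ =
      (1 - (1 - t) ^ 2 * u ^ 2) ^ (-(((q : ℂ) - 1) / 2)) *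
      (∏ μ ∈ BartholdiZeta.localSpectrum G x₀,
        BartholdiZeta.localFactor q u t μ ^ (-(BartholdiZeta.localMult G x₀ μ : ℂ))) *
      Complex.exp
        (BartholdiZeta.kernel (t • G.degMatrix ℂ - BartholdiZeta.pathOp G t 2) x₀ x₀ / 2 *
          (1 - t) * u ^ 2) *
      Complex.exp (∑' m : ℕ, BartholdiZeta.RTerm G u t x₀ x₀ (m + 3)) := by

  have : Nonempty V := ⟨x₀⟩
  have hmax : G.maxDegree = q + 1 := hG.maxDegree_eq
  have hquad := BartholdiZeta.alpha_sq (G := G) t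
  have hMr := BartholdiZeta.maxDegree_le_alpha (G := G) t
  have hr := BartholdiZeta.one_add_norm_le_alpha (G := G) ht (by omega)
  rw [hmax] at hquad hMr
  push_cast at hquad hMr
  refine ⟨fun x => ⟨(BartholdiZeta.hasSum_zetaTerm hG ht hr hMr hquad hu x₀ x).summable,
    (summable_nat_add_iff 3).mpr (BartholdiZeta.summable_RTerm hr hu
      (fun m y => BartholdiZeta.norm_kernel_pathOp_le hG ht hMr hquad m y y) x₀ x),
    BartholdiZeta.bartholdiZeta_eq hG ht hr hMr hquad hu x₀ x⟩, ?_⟩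
  have h := BartholdiZeta.bartholdiZeta_eq hG ht hr hMr hquad hu x₀ x₀
  rw [if_pos rfl, mul_one] at h
  exact h
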